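/- **Setting.** All operators act on finite dimensional complex Hilbert spaces. For positive operators $\rho,\sigma$ let $\operatorname{supp}\rho=(\ker\rho)^\perp$. Write $\rho\ll\sigma$ (or $\sigma\gg\rho$) if the compression of $\sigma$ to $\operatorname{supp}\rho$ is strictly positive, and $\rho\perp\sigma$ if that compression is $0$. A *quantum Lebesgue decomposition* of $\sigma$ with respect to $\rho$ is $\sigma=\sigma^a+\sigma^\perp$ with $\sigma^a,\sigma^\perp\ge 0$, $\sigma^a\ll\rho$ and $\sigma^\perp\perp\rho$. A *(version of the) quantum log-likelihood ratio* $\mathcal L(\sigma|\rho)$ is a Hermitian operator $\mathcal L$ with $\sigma^a=e^{\mathcal L/2}\rho\,e^{\mathcal L/2}$; by convention $\mathcal L(\rho|\rho)=0$. For observables (Hermitian operators) $X^{(n)}=(X^{(n)}_1,\dots,X^{(n)}_d)$ and density operators $\rho^{(n)}$ on $\mathcal H^{(n)}$, write $X^{(n)}\to N(0,J)$ under $\rho^{(n)}$ if for all $r$ and all $\xi_1,\dots,\xi_r\in\mathbb C^d$ $$\lim_{n\to\infty}\operatorname{Tr}\rho^{(n)}\prod_{t=1}^r e^{\sqrt{-1}\sum_i\xi_t^iX_i^{(n)}}=\exp\Big(-\tfrac12\sum_{t}\sum_{i,j}\xi_t^i\xi_t^jJ_{ji}-\sum_{t<u}\sum_{i,j}\xi_t^i\xi_u^jJ_{ji}\Big),$$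 the right-hand side being the quasi-characteristic function of the quantum Gaussian state $N(0,J)$. A sequence $R^{(n)}$ of observables is *infinitesimal*, $R^{(n)}=o(X^{(n)},\rho^{(n)})$, if for all $r$, $\xi_t\in\mathbb C^d$ and $\eta_t\in\mathbb C$ the limit of $\operatorname{Tr}\rho^{(n)}\prod_{t}e^{\sqrt{-1}(\sum_i\xi_t^iX_i^{(n)}+\eta_tR^{(n)})}$ is the same right-hand side. Let $\Theta\subset\mathbb R^d$ be open and $\theta_0\in\Theta$. Models $\{\rho^{(n)}_\theta\mid\theta\in\Theta\}$ of density operators on $\mathcal H^{(n)}$ are *q-LAN at $\theta_0$*, with observables $\Delta^{(n)}$ and a Hermitian positive semidefinite $d\times d$ matrix $J$, if (i) $\rho^{(n)}_\theta\gg\rho^{(n)}_{\theta_0}$ for all $\theta\in\Theta$ and all $n$; (ii) $\Delta^{(n)}\to N(0,J)$ under $\rho^{(n)}_{\theta_0}$, and $\operatorname{Re}J>0$; (iii) for (versions of) $\mathcal L^{(n)}_h=\mathcal L(\rho^{(n)}_{\theta_0+h/\sqrt n}|\rho^{(n)}_{\theta_0})$ and every $h\in\mathbb R^d$, $$\mathcal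 L^{(n)}_h=\sum_i h^i\Delta^{(n)}_i-\tfrac12\Big(\sum_{i,j}J_{ij}h^ih^j\Big)I+o(\Delta^{(n)},\rho^{(n)}_{\theta_0}).$$ **Theorem (q-LAN for i.i.d. models).** Let $\{\rho_\theta\mid\theta\in\Theta\}$, $\Theta\subset\mathbb R^d$ open, be a family of density operators on a finite dimensional Hilbert space $\mathcal H$, let $\theta_0\in\Theta$, and suppose $\rho_\theta\gg\rho_{\theta_0}$ for all $\theta\in\Theta$. Let $\mathcal L_h$ be a version of $\mathcal L(\rho_{\theta_0+h}|\rho_{\theta_0})$ for each $h$ with $\theta_0+h\in\Theta$, such that $\mathcal L_0=0$, $h\mapsto\mathcal L_h$ is differentiable at $h=0$, and $$\operatorname{Tr}\rho_{\theta_0}e^{\mathcal L_h}=1-o(\|h\|^2)\qquad(h\to0).$$ Then: 1. For all $n$ and $\theta\in\Theta$, if $M$ is a version of $\mathcal L(\rho_\theta|\rho_{\theta_0})$, then $\sum_{k=1}^nI^{\otimes(k-1)}\otimes M\otimes I^{\otimes(n-k)}$ is a version of $\mathcal L(\rho_\theta^{\otimes n}|\rho_{\theta_0}^{\otimes n})$.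 2. The operator $\partial_{h^i}\mathcal L_h|_{h=0}$ is a version of the $i$th symmetric logarithmic derivative (SLD) of the model at $\theta_0$, that is, a Hermitian operator $L_i$ with $\partial_i\rho_\theta|_{\theta=\theta_0}=\tfrac12(\rho_{\theta_0}L_i+L_i\rho_{\theta_0})$. 3. Let $L_1,\dots,L_d$ be any versions of the SLDs at $\theta_0$, and put $$\Delta^{(n)}_i=\frac1{\sqrt n}\sum_{k=1}^nI^{\otimes(k-1)}\otimes L_i\otimes I^{\otimes(n-k)},\qquad J_{ij}=\operatorname{Tr}\rho_{\theta_0}L_jL_i .$$ Then $J$ is Hermitian and positive semidefinite, and $\{\rho_\theta^{\otimes n}\}$ satisfies all the requirements of q-LAN at $\theta_0$ with these $\Delta^{(n)}$ and $J$, except possibly $\operatorname{Re}J>0$; the expansion (iii) holds for the versions $\mathcal L^{(n)}_h=\sum_{k=1}^nI^{\otimes(k-1)}\otimes\mathcal L_{h/\sqrt n}\otimes I^{\otimes(n-k)}$. It is q-LAN at $\theta_0$ with these $\Delta^{(n)}$ and $J$ (that is, also $\operatorname{Re}J>0$) if and only if the partial derivatives $\partial_1\rho_\theta,\dots,\partial_d\rho_\theta$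 at $\theta=\theta_0$ are linearly independent over $\mathbb R$. -/

import Mathlib

open scoped ComplexOrder Matrix Topology

noncomputable section

namespace QLAN

/-- The parameter space `ℝ^d`. -/
abbrev Param (d : ℕ) : Type := EuclideanSpace ℝ (Fin d)

/-! Operators on a finite dimensional Hilbert space are complex square matrices with respect to an
orthonormal basis indexed by a finite type. -/

section Operators

variable {D : Type*} [Fintype D] [DecidableEq D]

/-- Density operators: positive operators of trace one. -/
def IsDensity (ρ : Matrix D D ℂ) : Prop :=
  ρ.PosSemidef ∧ ρ.trace = 1

/-- The support `(ker ρ)^⊥` of an operator. -/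
def supp (ρ : Matrix D D ℂ) : Set (D → ℂ) :=
  {x | ∀ y : D → ℂ, ρ *ᵥ y = 0 → star y ⬝ᵥ x = 0}

/-- `ρ ≪ σ`: the excision of `σ` to `supp ρ` is strictly positive. -/
def AbsCont (ρ σ : Matrix D D ℂ) : Prop :=
  ∀ x ∈ supp ρ, x ≠ 0 → 0 < star x ⬝ᵥ (σ *ᵥ x)

/-- `ρ ⟂ σ`: the excision of `σ` to `supp ρ` vanishes. -/
def Singular (ρ σ : Matrix D D ℂ) : Prop :=
  ∀ x ∈ supp ρ, ∀ y ∈ supp ρ, star y ⬝ᵥ (σ *ᵥ x) = 0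

/-- `σ = σa + σs` is a quantum Lebesgue decomposition of `σ` with respect to `ρ`: both parts are
positive, `σa ≪ ρ` and `σs ⟂ ρ`. -/
structure IsLebesgueDecomp (ρ σ σa σs : Matrix D D ℂ) : Prop where
  eq_add : σ = σa + σs
  posSemidef_ac : σa.PosSemidef
  posSemidef_sing : σs.PosSemidef
  absCont : AbsCont σa ρ
  singular : Singular σs ρ

/-- `L` is (a version of) the quantum log-likelihood ratio `𝓛(σ | ρ)`: a Hermitian operator with
`σa = e^{L/2} ρ e^{L/2}`, where `σa` is the absolutely continuous part of `σ` with respect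
to `ρ`. -/
def IsLogLikelihoodRatio (σ ρ L : Matrix D D ℂ) : Prop :=
  L.IsHermitian ∧ ∃ σa σs : Matrix D D ℂ, IsLebesgueDecomp ρ σ σa σs ∧
    σa = NormedSpace.exp ((1 / 2 : ℂ) • L) * ρ * NormedSpace.exp ((1 / 2 : ℂ) • L)

end Operators

section TensorPowers

variable {D : Type*} [Fintype D] [DecidableEq D]

/-- The tensor product `A₁ ⊗ ⋯ ⊗ Aₙ`, as an operator on the `n`-fold tensor power of `ℂ^D`, whose
product orthonormal basis is indexed by `Fin n → D`. -/
def tensor {n : ℕ} (A : Fin n → Matrix D D ℂ) : Matrix (Fin n → D) (Fin n → D) ℂ :=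
  Matrix.of fun x y => ∏ k, A k (x k) (y k)

/-- The tensor power `A^{⊗ n}`. -/
def tensorPow (n : ℕ) (A : Matrix D D ℂ) : Matrix (Fin n → D) (Fin n → D) ℂ :=
  tensor fun _ => A

/-- `∑ₖ I^{⊗ (k-1)} ⊗ A ⊗ I^{⊗ (n-k)}`. -/
def siteSum (n : ℕ) (A : Matrix D D ℂ) : Matrix (Fin n → D) (Fin n → D) ℂ :=
  ∑ k : Fin n, tensor (Function.update (fun _ => (1 : Matrix D D ℂ)) k A)

/-- `n^{-1/2} ∑ₖ I^{⊗ (k-1)} ⊗ A ⊗ I^{⊗ (n-k)}`. -/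
def normalizedSum (n : ℕ) (A : Matrix D D ℂ) : Matrix (Fin n → D) (Fin n → D) ℂ :=
  (((Real.sqrt n)⁻¹ : ℝ) : ℂ) • siteSum n A

end TensorPowers

section Models

variable {d : ℕ} {D : Type*} [Fintype D] [DecidableEq D]

/-- The curve `t ↦ ρ_{θ₀ + t eᵢ}` through `ρ_{θ₀}` in the `i`th coordinate direction. -/
def coordCurve (ρ : Param d → Matrix D D ℂ) (θ₀ : Param d) (i : Fin d) (t : ℝ) : Matrix D D ℂ :=
  ρ (θ₀ + t • EuclideanSpace.single i (1 : ℝ))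

/-- `A` is (a version of) the `i`th symmetric logarithmic derivative of the model at `θ₀`:
it is Hermitian and `∂ᵢ ρ = (ρ A + A ρ) / 2` at `θ₀`. -/
def IsSLD (ρ : Param d → Matrix D D ℂ) (θ₀ : Param d) (i : Fin d) (A : Matrix D D ℂ) : Prop :=
  A.IsHermitian ∧
    HasDerivAt (coordCurve ρ θ₀ i) ((1 / 2 : ℂ) • (ρ θ₀ * A + A * ρ θ₀)) (0 : ℝ)

/-- `J i j = Tr ρ Aⱼ Aᵢ`. -/
def covMatrix (ρ₀ : Matrix D D ℂ) (A : Fin d → Matrix D D ℂ) : Matrix (Fin d) (Fin d) ℂ :=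
  Matrix.of fun i j => (ρ₀ * A j * A i).trace

end Models

section Convergence

/-- The quasi-characteristic function `φ(∏ₜ e^{√-1 ξₜ^i Xᵢ})` of the quantum Gaussian state
`(X, φ) ∼ N(m, J)`. -/
def gaussianQuasiChar {d : ℕ} (m : Fin d → ℝ) (J : Matrix (Fin d) (Fin d) ℂ)
    {r : ℕ} (ξ : Fin r → Fin d → ℂ) : ℂ :=
  Complex.exp
    ((∑ t, (Complex.I * (∑ i, ξ t i * (m i : ℂ)) - (1 / 2) * ∑ i, ∑ j, ξ t i * ξ t j * J j i))
      - ∑ t, ∑ u ∈ Finset.Ioi t, ∑ i, ∑ j, ξ t i * ξ u j * J j i)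

variable {d : ℕ} {D : ℕ → Type*} [∀ n, Fintype (D n)] [∀ n, DecidableEq (D n)]

/-- Convergence in law of the observables `X n` under the states `ρ n` to `N(m, J)`. -/
def ConvergesInLaw (X : ∀ n, Fin d → Matrix (D n) (D n) ℂ) (ρ : ∀ n, Matrix (D n) (D n) ℂ)
    (m : Fin d → ℝ) (J : Matrix (Fin d) (Fin d) ℂ) : Prop :=
  ∀ (r : ℕ) (ξ : Fin r → Fin d → ℂ),
    Filter.Tendsto
      (fun n => (ρ n * (List.ofFn fun t : Fin r =>
        NormedSpace.exp (Complex.I • ∑ i, ξ t i • X n i)).prod).trace)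
      Filter.atTop (𝓝 (gaussianQuasiChar m J ξ))

/-- The sequence `R n` is infinitesimal relative to the convergence in law of `X n` under `ρ n`
to `N(0, J)`. -/
def IsInfinitesimal (X : ∀ n, Fin d → Matrix (D n) (D n) ℂ) (ρ : ∀ n, Matrix (D n) (D n) ℂ)
    (J : Matrix (Fin d) (Fin d) ℂ) (R : ∀ n, Matrix (D n) (D n) ℂ) : Prop :=
  ∀ (r : ℕ) (ξ : Fin r → Fin d → ℂ) (η : Fin r → ℂ),
    Filter.Tendsto
      (fun n => (ρ n * (List.ofFn fun t : Fin r =>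
        NormedSpace.exp (Complex.I • (∑ i, ξ t i • X n i + η t • R n))).prod).trace)
      Filter.atTop (𝓝 (gaussianQuasiChar 0 J ξ))

/-- The local parameter point `θ₀ + h / √n`. -/
def localPoint (θ₀ : Param d) (n : ℕ) (h : Param d) : Param d :=
  θ₀ + (Real.sqrt n)⁻¹ • h

/-- The requirements of quantum local asymptotic normality at `θ₀` for the observables `Δ n`, the
covariance matrix `J` and the versions `L n h` of the quantum log-likelihood ratios
`𝓛(ρ n (θ₀ + h / √n) | ρ n θ₀)`, except for the nondegeneracy of `J`. -/
structure HasQLANExpansion (Θ : Set (Param d)) (θ₀ : Param d)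
    (ρ : ∀ n, Param d → Matrix (D n) (D n) ℂ)
    (Δ : ∀ n, Fin d → Matrix (D n) (D n) ℂ) (J : Matrix (Fin d) (Fin d) ℂ)
    (L : ∀ n, Param d → Matrix (D n) (D n) ℂ) : Prop where
  isOpen : IsOpen Θ
  mem : θ₀ ∈ Θ
  density : ∀ n, ∀ θ ∈ Θ, IsDensity (ρ n θ)
  absCont : ∀ n, ∀ θ ∈ Θ, AbsCont (ρ n θ₀) (ρ n θ)
  observable : ∀ n i, (Δ n i).IsHermitian
  posSemidef : J.PosSemidef
  convergesInLaw : ConvergesInLaw Δ (fun n => ρ n θ₀) 0 J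
  logLikelihoodRatio : ∀ n h, localPoint θ₀ n h ∈ Θ →
    IsLogLikelihoodRatio (ρ n (localPoint θ₀ n h)) (ρ n θ₀) (L n h)
  /-- The convention `𝓛(ρ | ρ) = 0` at the reference point. -/
  logLikelihoodRatio_zero : ∀ n, L n 0 = 0
  expansion : ∀ h : Param d, IsInfinitesimal Δ (fun n => ρ n θ₀) J fun n =>
    L n h - ((∑ i, (h i : ℂ) • Δ n i)
      - ((1 / 2 : ℂ) * ∑ i, ∑ j, J i j * (h i : ℂ) * (h j : ℂ)) • (1 : Matrix (D n) (D n) ℂ))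

/-- The sequence of models `ρ n` is quantum locally asymptotically normal (q-LAN) at `θ₀`, with
observables `Δ n`, covariance `J` and log-likelihood ratios `L n h`. -/
structure IsQLAN (Θ : Set (Param d)) (θ₀ : Param d)
    (ρ : ∀ n, Param d → Matrix (D n) (D n) ℂ)
    (Δ : ∀ n, Fin d → Matrix (D n) (D n) ℂ) (J : Matrix (Fin d) (Fin d) ℂ)
    (L : ∀ n, Param d → Matrix (D n) (D n) ℂ) : Prop
    extends HasQLANExpansion Θ θ₀ ρ Δ J L where
  posDef_re : (J.map Complex.re).PosDef

end Convergence

end QLAN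

end

/-!
The Gaussian limit is a central limit theorem: in the state `ρ^{⊗ n}`, a product of exponentials of
site sums has expectation `(Tr ρ ∏ₜ exp (Yₜ (1 / √n))) ^ n`, and only the second order expansion
of the single-site factor survives, giving `exp (∑ₜ Tr ρ Yₜ'² / 2 + ∑_{t < u} Tr ρ Yₜ' Yᵤ')`.

The trace condition controls the likelihood ratio twice. To first order it makes the singular part
of `ρ_{θ₀ + h}` negligible, so that differentiating `e^{L/2} ρ e^{L/2}` turns `∂ᵢ L` into a
symmetric logarithmic derivative; any two of these agree up to operators `W` with
`ρ W = W ρ = 0`, which do not contribute to the limit. To second order it fixes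
`Tr ρ L_h = - Tr ρ (∂_h L)² / 2 + o(‖h‖²)`, the constant term of the expansion.

Finally `xᵀ (Re J) x = Tr ρ X²` for `X = ∑ xᵢ Lᵢ` vanishes exactly when `ρ X = 0`, which is
equivalent to `ρ X + X ρ = 0`, a linear relation among the derivatives of the model.
-/

noncomputable section

namespace QLAN

section TensorAlgebra

variable {D : Type*} {n : ℕ}

/-- The tensor product of operators as a multilinear map of its factors. -/
def tensorMultilinear (D : Type*) (n : ℕ) :
    MultilinearMap ℂ (fun _ : Fin n => Matrix D D ℂ) (Matrix (Fin n → D) (Fin n → D) ℂ) where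
  toFun := tensor
  map_update_add' A k B C := Matrix.ext fun x y =>
    ((MultilinearMap.mkPiAlgebra ℂ (Fin n) ℂ).compLinearMap fun k =>
      Matrix.entryLinearMap ℂ ℂ (x k) (y k)).map_update_add A k B C
  map_update_smul' A k c B := Matrix.ext fun x y =>
    ((MultilinearMap.mkPiAlgebra ℂ (Fin n) ℂ).compLinearMap fun k =>
      Matrix.entryLinearMap ℂ ℂ (x k) (y k)).map_update_smul A k c B

theorem tensor_add (A B : Fin n → Matrix D D ℂ) :
    tensor (A + B) = ∑ s : Finset (Fin n), tensor (s.piecewise A B) :=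
  (tensorMultilinear D n).map_add_univ A B

theorem conjTranspose_tensor (A : Fin n → Matrix D D ℂ) :
    (tensor A)ᴴ = tensor fun k => (A k)ᴴ := by
  ext x y
  simp [tensor]

theorem tensor_one [DecidableEq D] : tensor (1 : Fin n → Matrix D D ℂ) = 1 := by
  ext x y
  simp only [tensor, Matrix.of_apply, Pi.one_apply, Matrix.one_apply, Finset.prod_ite_zero,
    Finset.prod_const_one, Finset.mem_univ, true_implies, funext_iff]

section Fintype

variable [Fintype D]

theorem tensor_mul (A B : Fin n → Matrix D D ℂ) : tensor (A * B) = tensor A * tensor B := by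
  ext x y
  simp only [tensor, Matrix.mul_apply, Matrix.of_apply, Pi.mul_apply, Finset.prod_univ_sum,
    Fintype.piFinset_univ, Finset.prod_mul_distrib]

theorem trace_tensor (A : Fin n → Matrix D D ℂ) : (tensor A).trace = ∏ k, (A k).trace := by
  simp only [tensor, Matrix.trace, Matrix.diag, Matrix.of_apply, Finset.prod_univ_sum,
    Fintype.piFinset_univ]

theorem tensorPow_mul (A B : Matrix D D ℂ) : tensorPow n (A * B) = tensorPow n A * tensorPow n B :=
  tensor_mul _ _

theorem trace_tensorPow (A : Matrix D D ℂ) : (tensorPow n A).trace = A.trace ^ n := by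
  simp [tensorPow, trace_tensor]

end Fintype

open scoped MatrixOrder in
theorem posSemidef_tensor [Finite D] {A : Fin n → Matrix D D ℂ} (hA : ∀ k, (A k).PosSemidef) :
    (tensor A).PosSemidef := by
  classical
  have := Fintype.ofFinite D
  choose C hC using fun k => CStarAlgebra.nonneg_iff_eq_star_mul_self.mp (hA k).nonneg
  obtain rfl : A = (fun k => (C k)ᴴ) * C := funext hC
  rw [tensor_mul, ← conjTranspose_tensor]
  exact Matrix.posSemidef_conjTranspose_mul_self _

theorem posSemidef_tensorPow_add_sub [Finite D] {A B : Matrix D D ℂ} (hA : A.PosSemidef)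
    (hB : B.PosSemidef) : (tensorPow n (A + B) - tensorPow n A).PosSemidef := by
  have expand : tensorPow n (A + B) - tensorPow n A
      = ∑ s ∈ Finset.univ.erase (Finset.univ : Finset (Fin n)),
        tensor (s.piecewise (fun _ => A) fun _ => B) := by
    rw [Finset.sum_erase_eq_sub (Finset.mem_univ _), ← tensor_add, Finset.piecewise_univ]
    rfl
  rw [expand]
  refine Matrix.posSemidef_sum _ fun s _ => posSemidef_tensor fun k => ?_
  by_cases hk : k ∈ s <;> simp [hk, hA, hB]

theorem IsDensity.tensorPow [Fintype D] {ρ : Matrix D D ℂ} (hρ : IsDensity ρ) :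
    IsDensity (tensorPow n ρ) :=
  ⟨posSemidef_tensor fun _ => hρ.1, by rw [trace_tensorPow, hρ.2, one_pow]⟩

end TensorAlgebra

section SiteSums

variable {D : Type*} [DecidableEq D] {n : ℕ}

theorem isHermitian_siteSum {A : Matrix D D ℂ} (hA : A.IsHermitian) :
    (siteSum n A).IsHermitian := by
  rw [Matrix.IsHermitian, siteSum, Matrix.conjTranspose_sum]
  refine Finset.sum_congr rfl fun k _ => ?_
  rw [conjTranspose_tensor]
  congr 1
  funext j
  obtain rfl | hj := eq_or_ne j k <;> simp [*, hA.eq]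

theorem isHermitian_normalizedSum {A : Matrix D D ℂ} (hA : A.IsHermitian) :
    (normalizedSum n A).IsHermitian := by
  rw [Matrix.IsHermitian, normalizedSum, Matrix.conjTranspose_smul, (isHermitian_siteSum hA).eq,
    Complex.star_def, Complex.conj_ofReal]

/-- `siteSum n` as a linear map. -/
def siteSumLinear (D : Type*) [DecidableEq D] (n : ℕ) :
    Matrix D D ℂ →ₗ[ℂ] Matrix (Fin n → D) (Fin n → D) ℂ :=
  ∑ k, (tensorMultilinear D n).toLinearMap 1 k

theorem siteSumLinear_apply (A : Matrix D D ℂ) : siteSumLinear D n A = siteSum n A :=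
  LinearMap.sum_apply _ _ _

theorem siteSum_add (A B : Matrix D D ℂ) : siteSum n (A + B) = siteSum n A + siteSum n B := by
  simp only [← siteSumLinear_apply, map_add]

theorem siteSum_sub (A B : Matrix D D ℂ) : siteSum n (A - B) = siteSum n A - siteSum n B := by
  simp only [← siteSumLinear_apply, map_sub]

theorem siteSum_smul (c : ℂ) (A : Matrix D D ℂ) : siteSum n (c • A) = c • siteSum n A := by
  simp only [← siteSumLinear_apply, map_smul]

theorem siteSum_sum_smul {ι : Type*} [Fintype ι] (x : ι → ℂ) (A : ι → Matrix D D ℂ) :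
    siteSum n (∑ i, x i • A i) = ∑ i, x i • siteSum n (A i) := by
  simp only [← siteSumLinear_apply, map_sum, map_smul]

theorem sum_smul_normalizedSum {ι : Type*} [Fintype ι] (x : ι → ℂ) (A : ι → Matrix D D ℂ) :
    ∑ i, x i • normalizedSum n (A i) = siteSum n ((Real.sqrt n)⁻¹ • ∑ i, x i • A i) := by
  rw [← Complex.coe_smul, siteSum_smul, siteSum_sum_smul, Finset.smul_sum]
  exact Finset.sum_congr rfl fun i _ => smul_comm _ _ _

theorem siteSum_one : siteSum n (1 : Matrix D D ℂ) = (n : ℂ) • 1 := by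
  have hone (k : Fin n) : tensor (Function.update (fun _ => (1 : Matrix D D ℂ)) k 1) = 1 :=
    (congrArg tensor (Function.update_eq_self k fun _ => (1 : Matrix D D ℂ))).trans tensor_one
  simp only [siteSum, hone, Finset.sum_const, Finset.card_univ, Fintype.card_fin,
    Nat.cast_smul_eq_nsmul]

variable [Fintype D]

/-- The tensor product of operators as a multiplicative map of its family of factors. -/
def tensorHom (D : Type*) [Fintype D] [DecidableEq D] (n : ℕ) :
    (Fin n → Matrix D D ℂ) →* Matrix (Fin n → D) (Fin n → D) ℂ where
  toFun := tensor
  map_one' := tensor_one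
  map_mul' := tensor_mul

/-- The embedding `A ↦ I ⊗ ⋯ ⊗ A ⊗ ⋯ ⊗ I` of the operators at site `k`. -/
def siteHom (k : Fin n) : Matrix D D ℂ →ₐ[ℂ] Matrix (Fin n → D) (Fin n → D) ℂ :=
  AlgHom.ofLinearMap ((tensorMultilinear D n).toLinearMap 1 k)
    (map_one ((tensorHom D n).comp (MonoidHom.mulSingle _ k)))
    (map_mul ((tensorHom D n).comp (MonoidHom.mulSingle _ k)))

theorem commute_siteHom {k l : Fin n} (hkl : k ≠ l) (A B : Matrix D D ℂ) :
    Commute (siteHom k A) (siteHom l B) :=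
  Commute.map (Pi.mulSingle_commute (f := fun _ : Fin n => Matrix D D ℂ) hkl A B) (tensorHom D n)

open scoped Matrix.Norms.Operator in
theorem exp_siteHom (k : Fin n) (A : Matrix D D ℂ) :
    NormedSpace.exp (siteHom k A) = siteHom k (NormedSpace.exp A) :=
  (NormedSpace.map_exp (siteHom k)
    (LinearMap.continuous_of_finiteDimensional (siteHom k).toLinearMap) A).symm

theorem exp_sum_siteHom (A : Fin n → Matrix D D ℂ) :
    NormedSpace.exp (∑ k, siteHom k (A k)) = tensor fun k => NormedSpace.exp (A k) := by
  rw [Matrix.exp_sum_of_commute _ _ fun k _ l _ hkl => commute_siteHom hkl _ _]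
  simp only [exp_siteHom]
  rw [← Finset.noncommProd_mulSingle fun k => NormedSpace.exp (A k)]
  exact (Finset.map_noncommProd _ _ _ (tensorHom D n)).symm

theorem exp_siteSum (A : Matrix D D ℂ) :
    NormedSpace.exp (siteSum n A) = tensorPow n (NormedSpace.exp A) :=
  exp_sum_siteHom fun _ => A

theorem exp_half_siteSum (A : Matrix D D ℂ) :
    NormedSpace.exp ((1 / 2 : ℂ) • siteSum n A)
      = tensorPow n (NormedSpace.exp ((1 / 2 : ℂ) • A)) := by
  rw [← exp_siteSum, siteSum_smul]

theorem prod_exp_siteSum {r : ℕ} (Y : Fin r → Matrix D D ℂ) :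
    (List.ofFn fun t => NormedSpace.exp (siteSum n (Y t))).prod
      = tensorPow n (List.ofFn fun t => NormedSpace.exp (Y t)).prod := by
  have h := map_list_prod ((tensorHom D n).comp (Pi.constMonoidHom (Fin n) _))
    (List.ofFn fun t => NormedSpace.exp (Y t))
  rw [List.map_ofFn] at h
  simp only [exp_siteSum]
  exact h.symm

end SiteSums

section PositiveOperators

variable {𝕜 D : Type*} [RCLike 𝕜] [Fintype D]

theorem trace_mul_mul_conjTranspose_nonneg {ρ : Matrix D D 𝕜} (hρ : ρ.PosSemidef)
    (X : Matrix D D 𝕜) : 0 ≤ (ρ * X * Xᴴ).trace := by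
  rw [Matrix.trace_mul_cycle]
  exact (hρ.conjTranspose_mul_mul_same X).trace_nonneg

open scoped MatrixOrder in
theorem trace_mul_mul_conjTranspose_eq_zero_iff {ρ X : Matrix D D 𝕜} (hρ : ρ.PosSemidef) :
    (ρ * X * Xᴴ).trace = 0 ↔ ρ * X = 0 := by
  classical
  refine ⟨fun h => ?_, fun h => by rw [h, zero_mul, Matrix.trace_zero]⟩
  obtain ⟨B, rfl⟩ := CStarAlgebra.nonneg_iff_eq_star_mul_self.mp hρ.nonneg
  have hBX : (B * X * (B * X)ᴴ).trace = 0 := by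
    rwa [Matrix.conjTranspose_mul, ← mul_assoc, Matrix.trace_mul_comm, ← mul_assoc, ← mul_assoc]
  rw [mul_assoc, Matrix.trace_mul_conjTranspose_self_eq_zero_iff.mp hBX, mul_zero]

theorem mul_eq_zero_comm_of_isHermitian {A B : Matrix D D 𝕜} (hA : A.IsHermitian)
    (hB : B.IsHermitian) : A * B = 0 ↔ B * A = 0 := by
  rw [← Matrix.conjTranspose_eq_zero, Matrix.conjTranspose_mul, hA.eq, hB.eq]

theorem mul_add_mul_eq_zero_iff {ρ K : Matrix D D 𝕜} (hρ : ρ.PosSemidef) (hK : K.IsHermitian) :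
    ρ * K + K * ρ = 0 ↔ ρ * K = 0 := by
  refine ⟨fun h => ?_, fun h => by
    rw [h, (mul_eq_zero_comm_of_isHermitian hρ.isHermitian hK).mp h, add_zero]⟩
  have htrace : (ρ * K * K).trace + (ρ * K * K).trace = 0 := by
    simpa only [add_mul, Matrix.trace_add, zero_mul, Matrix.trace_zero,
      Matrix.trace_mul_cycle K ρ K, Matrix.trace_mul_cycle K K ρ] using congr(Matrix.trace ($h * K))
  rw [← trace_mul_mul_conjTranspose_eq_zero_iff hρ, hK.eq]
  exact add_self_eq_zero.mp htrace

end PositiveOperators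

section Exponential

theorem isHermitian_half_smul {D : Type*} {L : Matrix D D ℂ} (hL : L.IsHermitian) :
    ((1 / 2 : ℂ) • L).IsHermitian :=
  hL.smul (by simp [IsSelfAdjoint])

variable {D : Type*} [Fintype D] [DecidableEq D]

theorem exp_half_mul_exp_half (L : Matrix D D ℂ) :
    NormedSpace.exp ((1 / 2 : ℂ) • L) * NormedSpace.exp ((1 / 2 : ℂ) • L)
      = NormedSpace.exp L := by
  rw [← Matrix.exp_add_of_commute _ _ (Commute.refl _), ← add_smul, add_halves, one_smul]

theorem posDef_exp {L : Matrix D D ℂ} (hL : L.IsHermitian) : (NormedSpace.exp L).PosDef := by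
  rw [← exp_half_mul_exp_half]
  nth_rw 1 [← (isHermitian_half_smul hL).exp.eq]
  exact Matrix.PosDef.conjTranspose_mul_self _
    (Matrix.mulVec_injective_iff_isUnit.mpr (Matrix.isUnit_exp _))

theorem posDef_exp_half {L : Matrix D D ℂ} (hL : L.IsHermitian) :
    (NormedSpace.exp ((1 / 2 : ℂ) • L)).PosDef :=
  posDef_exp (isHermitian_half_smul hL)

end Exponential

section Support

variable {D : Type*} [Fintype D] {A E P ρ σ : Matrix D D ℂ}

theorem star_mulVec_dotProduct (hA : A.IsHermitian) (x y : D → ℂ) :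
    star (A *ᵥ x) ⬝ᵥ y = star x ⬝ᵥ (A *ᵥ y) := by
  rw [Matrix.star_mulVec, hA.eq, Matrix.dotProduct_mulVec]

theorem mulVec_mem_supp (hA : A.IsHermitian) (x : D → ℂ) : A *ᵥ x ∈ supp A := by
  intro y hy
  rw [← star_mulVec_dotProduct hA, hy, star_zero, zero_dotProduct]

theorem singular_iff_mul_eq_zero (hσ : σ.IsHermitian) (hρ : ρ.PosSemidef) :
    Singular σ ρ ↔ ρ * σ = 0 := by
  classical
  constructor
  · intro hsing
    refine Matrix.ext_of_mulVec_single fun i => ?_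
    have hmem := mulVec_mem_supp hσ (Pi.single i 1)
    rw [← Matrix.mulVec_mulVec, Matrix.zero_mulVec]
    exact (hρ.dotProduct_mulVec_zero_iff _).mp (hsing _ hmem _ hmem)
  · intro hmul x hx y _
    have hmul' := (mul_eq_zero_comm_of_isHermitian hρ.isHermitian hσ).mp hmul
    rw [← star_mulVec_dotProduct hρ.isHermitian]
    exact hx _ (by rw [Matrix.mulVec_mulVec, hmul', Matrix.zero_mulVec])

theorem absCont_of_mulVec_ne_zero (hρ : ρ.PosSemidef)
    (h : ∀ x ∈ supp σ, x ≠ 0 → ρ *ᵥ x ≠ 0) : AbsCont σ ρ := fun x hx hx0 =>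
  (hρ.dotProduct_mulVec_nonneg x).lt_of_ne fun h0 =>
    h x hx hx0 ((hρ.dotProduct_mulVec_zero_iff x).mp h0.symm)

theorem AbsCont.add_posSemidef (h : AbsCont ρ σ) (hP : P.PosSemidef) : AbsCont ρ (σ + P) := by
  intro x hx hx0
  rw [Matrix.add_mulVec, dotProduct_add]
  exact add_pos_of_pos_of_nonneg (h x hx hx0) (hP.dotProduct_mulVec_nonneg x)

theorem posSemidef_conj_posDef (hE : E.PosDef) (hρ : ρ.PosSemidef) : (E * ρ * E).PosSemidef := by
  simpa only [hE.isHermitian.eq] using hρ.conjTranspose_mul_mul_same E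

theorem absCont_conj_left (hE : E.PosDef) (hρ : ρ.PosSemidef) : AbsCont (E * ρ * E) ρ := by
  classical
  refine absCont_of_mulVec_ne_zero hρ fun x hx hx0 hρx => ?_
  have hker : (E * ρ * E) *ᵥ (E⁻¹ *ᵥ x) = 0 := by
    rw [Matrix.mulVec_mulVec, mul_assoc,
      Matrix.mul_nonsing_inv _ ((Matrix.isUnit_iff_isUnit_det _).mp hE.isUnit), mul_one,
      ← Matrix.mulVec_mulVec, hρx, Matrix.mulVec_zero]
  have horth := hx _ hker
  rw [star_mulVec_dotProduct hE.inv.isHermitian] at horth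
  exact (hE.inv.dotProduct_mulVec_pos hx0).ne' horth

theorem absCont_conj_right (hE : E.PosDef) (hρ : ρ.PosSemidef) : AbsCont ρ (E * ρ * E) := by
  classical
  refine absCont_of_mulVec_ne_zero (posSemidef_conj_posDef hE hρ) fun x hx hx0 hker => ?_
  have hρEx : ρ *ᵥ (E *ᵥ x) = 0 :=
    Matrix.mulVec_injective_iff_isUnit.mpr hE.isUnit (by
      rw [Matrix.mulVec_mulVec, Matrix.mulVec_mulVec, hker, Matrix.mulVec_zero])
  have horth := hx _ hρEx
  rw [star_mulVec_dotProduct hE.isHermitian] at horth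
  exact (hE.dotProduct_mulVec_pos hx0).ne' horth

end Support

section LogLikelihoodRatio

variable {D : Type*} [Fintype D] [DecidableEq D] {ρ σ M : Matrix D D ℂ}

theorem IsLogLikelihoodRatio.absCont (hM : IsLogLikelihoodRatio σ ρ M) (hρ : ρ.PosSemidef) :
    AbsCont ρ σ := by
  obtain ⟨hherm, _, σs, hdecomp, rfl⟩ := hM
  rw [hdecomp.eq_add]
  exact (absCont_conj_right (posDef_exp_half hherm) hρ).add_posSemidef hdecomp.posSemidef_sing

theorem IsLogLikelihoodRatio.siteSum (hM : IsLogLikelihoodRatio σ ρ M) (hρ : ρ.PosSemidef)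
    (n : ℕ) :
    IsLogLikelihoodRatio (tensorPow n σ) (tensorPow n ρ) (siteSum n M) := by
  obtain ⟨hherm, σa, σs, ⟨rfl, hσa, hσs, -, hsing⟩, hconj⟩ := hM
  have hρn : (tensorPow n ρ).PosSemidef := posSemidef_tensor fun _ => hρ
  have hhermn := isHermitian_siteSum (n := n) hherm
  have hsingn := posSemidef_tensorPow_add_sub (n := n) hσa hσs
  have hconjn : tensorPow n σa = NormedSpace.exp ((1 / 2 : ℂ) • QLAN.siteSum n M) * tensorPow n ρ
      * NormedSpace.exp ((1 / 2 : ℂ) • QLAN.siteSum n M) := by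
    rw [hconj, exp_half_siteSum, tensorPow_mul, tensorPow_mul]
  refine ⟨hhermn, tensorPow n σa, tensorPow n (σa + σs) - tensorPow n σa,
    ⟨(add_sub_cancel _ _).symm, posSemidef_tensor fun _ => hσa, hsingn, ?_, ?_⟩, hconjn⟩
  · rw [hconjn]
    exact absCont_conj_left (posDef_exp_half hhermn) hρn
  · rw [singular_iff_mul_eq_zero hsingn.isHermitian hρn, mul_sub, ← tensorPow_mul, ← tensorPow_mul,
      mul_add, (singular_iff_mul_eq_zero hσs.isHermitian hρ).mp hsing, add_zero, sub_self]

end LogLikelihoodRatio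

section Covariance

theorem isHermitian_sum_ofReal_smul {ι D : Type*} [Fintype ι] {A : ι → Matrix D D ℂ}
    (hA : ∀ i, (A i).IsHermitian) (x : ι → ℝ) : (∑ i, (x i : ℂ) • A i).IsHermitian :=
  isSelfAdjoint_sum _ fun i _ => (hA i).smul (Complex.conj_ofReal (x i))

variable {d : ℕ} {D : Type*} [Fintype D] {ρ : Matrix D D ℂ} {A : Fin d → Matrix D D ℂ}

theorem trace_mul_sum_mul_sum (ρ : Matrix D D ℂ) (A : Fin d → Matrix D D ℂ) (x y : Fin d → ℂ) :
    (ρ * (∑ i, x i • A i) * ∑ j, y j • A j).trace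
      = ∑ i, ∑ j, x i * y j * covMatrix ρ A j i := by
  simp only [covMatrix, Matrix.of_apply, Finset.mul_sum, Finset.sum_mul, Matrix.trace_sum,
    mul_smul_comm, smul_mul_assoc, Matrix.trace_smul, smul_eq_mul, mul_assoc]
  rw [Finset.sum_comm]
  exact Finset.sum_congr rfl fun i _ => Finset.sum_congr rfl fun j _ => mul_left_comm _ _ _

theorem isHermitian_covMatrix (hρ : ρ.IsHermitian) (hA : ∀ i, (A i).IsHermitian) :
    (covMatrix ρ A).IsHermitian := by
  ext i j
  rw [Matrix.conjTranspose_apply, covMatrix, Matrix.of_apply, Matrix.of_apply,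
    ← Matrix.trace_conjTranspose, Matrix.conjTranspose_mul, Matrix.conjTranspose_mul, (hA i).eq,
    (hA j).eq, hρ.eq, ← mul_assoc, Matrix.trace_mul_cycle, Matrix.trace_mul_cycle]

theorem posSemidef_covMatrix (hρ : ρ.PosSemidef) (hA : ∀ i, (A i).IsHermitian) :
    (covMatrix ρ A).PosSemidef := by
  refine .of_dotProduct_mulVec_nonneg (isHermitian_covMatrix hρ.isHermitian hA) fun x => ?_
  have hsum : (∑ i, x i • A i)ᴴ = ∑ i, star (x i) • A i := by
    simp only [Matrix.conjTranspose_sum, Matrix.conjTranspose_smul, (hA _).eq]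
  have hnonneg := trace_mul_mul_conjTranspose_nonneg hρ (∑ i, x i • A i)
  rw [hsum, trace_mul_sum_mul_sum, Finset.sum_comm] at hnonneg
  refine hnonneg.trans_eq ?_
  simp only [dotProduct, Matrix.mulVec, Finset.mul_sum, Pi.star_apply]
  exact Finset.sum_congr rfl fun i _ => Finset.sum_congr rfl fun j _ => by ring

theorem re_quadratic_covMatrix (ρ : Matrix D D ℂ) (A : Fin d → Matrix D D ℂ) (x : Fin d → ℝ) :
    star x ⬝ᵥ ((covMatrix ρ A).map Complex.re *ᵥ x)
      = (ρ * (∑ i, (x i : ℂ) • A i) * ∑ i, (x i : ℂ) • A i).trace.re := by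
  rw [trace_mul_sum_mul_sum, Finset.sum_comm]
  simp only [dotProduct, Matrix.mulVec, Finset.mul_sum, Pi.star_apply, star_trivial,
    Complex.re_sum, Matrix.map_apply, ← Complex.ofReal_mul, Complex.re_ofReal_mul]
  exact Finset.sum_congr rfl fun i _ => Finset.sum_congr rfl fun j _ => by ring

theorem re_quadratic_covMatrix_nonneg (hρ : ρ.PosSemidef) (hA : ∀ i, (A i).IsHermitian)
    (x : Fin d → ℝ) : 0 ≤ star x ⬝ᵥ ((covMatrix ρ A).map Complex.re *ᵥ x) := by
  have hnonneg := trace_mul_mul_conjTranspose_nonneg hρ (∑ i, (x i : ℂ) • A i)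
  rw [(isHermitian_sum_ofReal_smul hA x).eq] at hnonneg
  exact (re_quadratic_covMatrix ρ A x).symm ▸ (Complex.nonneg_iff.mp hnonneg).1

theorem re_quadratic_covMatrix_eq_zero_iff (hρ : ρ.PosSemidef) (hA : ∀ i, (A i).IsHermitian)
    (x : Fin d → ℝ) :
    star x ⬝ᵥ ((covMatrix ρ A).map Complex.re *ᵥ x) = 0
      ↔ ∑ i, x i • ((1 / 2 : ℂ) • (ρ * A i + A i * ρ)) = 0 := by
  have hsum : ∑ i, x i • ((1 / 2 : ℂ) • (ρ * A i + A i * ρ))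
      = (1 / 2 : ℂ) • (ρ * (∑ i, (x i : ℂ) • A i) + (∑ i, (x i : ℂ) • A i) * ρ) := by
    simp only [Finset.mul_sum, Finset.sum_mul, ← Finset.sum_add_distrib, Finset.smul_sum,
      mul_smul_comm, smul_mul_assoc, ← smul_add, Complex.coe_smul, smul_comm (x _)]
  have hX := isHermitian_sum_ofReal_smul hA x
  have hnonneg := trace_mul_mul_conjTranspose_nonneg hρ (∑ i, (x i : ℂ) • A i)
  rw [hsum, smul_eq_zero_iff_right (by norm_num), mul_add_mul_eq_zero_iff hρ hX,
    ← trace_mul_mul_conjTranspose_eq_zero_iff hρ, re_quadratic_covMatrix]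
  rw [hX.eq] at hnonneg ⊢
  exact ⟨fun h => Complex.ext h (Complex.nonneg_iff.mp hnonneg).2.symm,
    fun h => congr(Complex.re $h)⟩

theorem posDef_re_covMatrix_iff (hρ : ρ.PosSemidef) (hA : ∀ i, (A i).IsHermitian) :
    ((covMatrix ρ A).map Complex.re).PosDef ↔
      LinearIndependent ℝ fun i => (1 / 2 : ℂ) • (ρ * A i + A i * ρ) := by
  rw [Fintype.linearIndependent_iff]
  simp only [← re_quadratic_covMatrix_eq_zero_iff hρ hA]
  constructor
  · intro hpos x hx
    by_contra! hne
    exact (hpos.dotProduct_mulVec_pos (Function.ne_iff.mpr hne)).ne' hx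
  · intro hindep
    have hherm :=
      (isHermitian_covMatrix hρ.isHermitian hA).map Complex.re fun z => Complex.conj_re z
    exact .of_dotProduct_mulVec_pos hherm fun x hx =>
      (re_quadratic_covMatrix_nonneg hρ hA x).lt_of_ne fun h0 => hx (funext (hindep x h0.symm))

end Covariance

section SecondOrderExpansion

open Filter Asymptotics

theorem isBigO_id_of_hasDerivAt {E : Type*} [NormedAddCommGroup E] [NormedSpace ℝ E] {a : ℝ → E}
    {z : E} (ha0 : a 0 = 0) (ha : HasDerivAt a z 0) : a =O[𝓝 0] fun s => s := by
  simpa only [ha0, sub_zero] using ha.isBigO_sub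

theorem isLittleO_sub_smul_of_hasDerivAt {E : Type*} [NormedAddCommGroup E] [NormedSpace ℝ E]
    {a : ℝ → E} {z : E} (ha0 : a 0 = 0) (ha : HasDerivAt a z 0) :
    (fun s => a s - s • z) =o[𝓝 0] fun s => s := by
  simpa only [ha0, sub_zero] using ha.isLittleO

theorem hasDerivAt_zero_of_isLittleO {E : Type*} [NormedAddCommGroup E] [NormedSpace ℝ E]
    {f : ℝ → E} (hf : f =o[𝓝 0] fun s => s) : HasDerivAt f 0 0 := by
  have hf' : f =O[𝓝 0] fun s => ‖s - 0‖ ^ 1 := by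
    simpa only [sub_zero, pow_one] using hf.isBigO.norm_right
  rw [hasDerivAt_iff_isLittleO, hf'.eq_zero_of_norm_pow one_ne_zero]
  simpa only [sub_zero, smul_zero] using hf

variable {𝔸 : Type*} [NormedRing 𝔸] [NormedAlgebra ℝ 𝔸]

theorem isLittleO_mul_sub_sq_smul {a b : ℝ → 𝔸} {z w : 𝔸} (ha0 : a 0 = 0) (ha : HasDerivAt a z 0)
    (hb0 : b 0 = 0) (hb : HasDerivAt b w 0) :
    (fun s => a s * b s - s ^ 2 • (z * w)) =o[𝓝 0] fun s => s ^ 2 := by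
  have hz : (fun s : ℝ => s • z) =O[𝓝 0] fun s => s := by
    simpa only [smul_eq_mul, mul_one] using
      (isBigO_refl (fun s : ℝ => s) (𝓝 0)).smul (isBigO_const_const z (one_ne_zero (α := ℝ)) _)
  have hleft :=
    (isLittleO_sub_smul_of_hasDerivAt ha0 ha).mul_isBigO (isBigO_id_of_hasDerivAt hb0 hb)
  have hright := hz.mul_isLittleO (isLittleO_sub_smul_of_hasDerivAt hb0 hb)
  refine (hleft.add hright).congr (fun s => ?_) fun s => (sq s).symm
  rw [sub_mul, mul_sub, sub_add_sub_cancel, smul_mul_smul_comm, ← sq]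

/-- The expansion `f s = 1 + a s + s² q + o(s²)` as `s → 0`, where the first order part `a` is a
curve through `0` with derivative `z` there. Keeping `a` instead of `s z` allows `a` to be
differentiable only once. -/
structure HasSecondOrderExpansion (f a : ℝ → 𝔸) (z q : 𝔸) : Prop where
  map_zero : a 0 = 0
  hasDerivAt : HasDerivAt a z 0
  isLittleO : (fun s => f s - (1 + a s + s ^ 2 • q)) =o[𝓝 0] fun s => s ^ 2

namespace HasSecondOrderExpansion

variable {f g a b : ℝ → 𝔸} {z w p q : 𝔸}

theorem one : HasSecondOrderExpansion (fun _ => (1 : 𝔸)) (fun _ => 0) 0 0 where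
  map_zero := rfl
  hasDerivAt := hasDerivAt_const _ _
  isLittleO := by simp

theorem isBigO_remainder (hf : HasSecondOrderExpansion f a z q) :
    (fun s => f s - (1 + a s + s ^ 2 • q)) =O[𝓝 0] fun s => ‖s - 0‖ ^ 2 := by
  simpa only [sub_zero, Real.norm_eq_abs, sq_abs] using hf.isLittleO.isBigO

theorem apply_zero (hf : HasSecondOrderExpansion f a z q) : f 0 = 1 := by
  simpa [hf.map_zero, sub_eq_zero] using hf.isBigO_remainder.eq_zero_of_norm_pow two_ne_zero

theorem hasDerivAt_apply (hf : HasSecondOrderExpansion f a z q) : HasDerivAt f z 0 := by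
  have hsq : HasDerivAt (fun s : ℝ => s ^ 2 • q) 0 0 := by
    simpa using (hasDerivAt_pow 2 (0 : ℝ)).smul_const q
  have hsum := (hf.isBigO_remainder.hasFDerivAt one_lt_two).hasDerivAt.add
    ((hf.hasDerivAt.const_add 1).add hsq)
  simpa [Pi.add_def] using hsum

-- The second order cross term is isolated by `f g = f + g - 1 + (f - 1) (g - 1)`.
theorem mul (hf : HasSecondOrderExpansion f a z p) (hg : HasSecondOrderExpansion g b w q) :
    HasSecondOrderExpansion (f * g) (a + b) (z + w) (p + q + z * w) where
  map_zero := by simp [hf.map_zero, hg.map_zero]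
  hasDerivAt := hf.hasDerivAt.add hg.hasDerivAt
  isLittleO := by
    have hprod := isLittleO_mul_sub_sq_smul (a := fun s => f s - 1) (b := fun s => g s - 1)
      (sub_eq_zero.mpr hf.apply_zero) (hf.hasDerivAt_apply.sub_const 1)
      (sub_eq_zero.mpr hg.apply_zero) (hg.hasDerivAt_apply.sub_const 1)
    refine ((hf.isLittleO.add hg.isLittleO).add hprod).congr_left fun s => ?_
    simp only [Pi.mul_apply, Pi.add_apply, smul_add]
    noncomm_ring

theorem apply_isLittleO {E : Type*} [NormedAddCommGroup E] [NormedSpace ℝ E]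
    (hf : HasSecondOrderExpansion f a z q) (φ : 𝔸 →L[ℝ] E)
    (ha : (fun s => φ (a s)) =o[𝓝 0] fun s => s ^ 2) :
    (fun s => φ (f s) - (φ 1 + s ^ 2 • φ q)) =o[𝓝 0] fun s => s ^ 2 := by
  refine (((φ.isBigO_comp _ _).trans_isLittleO hf.isLittleO).add ha).congr_left fun s => ?_
  simp only [map_sub, map_add, map_smul]
  abel

end HasSecondOrderExpansion

variable [CompleteSpace 𝔸]

theorem isBigO_exp_sub_quadratic :
    (fun y : 𝔸 => NormedSpace.exp y - (1 + y + (1 / 2 : ℝ) • (y * y))) =O[𝓝 0]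
      fun y => ‖y‖ ^ 3 := by
  have htaylor :=
    (NormedSpace.exp_hasFPowerSeriesAt_zero (𝕂 := ℝ) (𝔸 := 𝔸)).isBigO_sub_partialSum_pow 3
  refine htaylor.congr_left fun y => ?_
  simp [FormalMultilinearSeries.partialSum, Finset.sum_range_succ,
    NormedSpace.expSeries_apply_eq, sq, Nat.factorial]

theorem HasSecondOrderExpansion.exp {a : ℝ → 𝔸} {z : 𝔸} (ha0 : a 0 = 0) (ha : HasDerivAt a z 0) :
    HasSecondOrderExpansion (fun s => NormedSpace.exp (a s)) a z ((1 / 2 : ℝ) • (z * z)) where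
  map_zero := ha0
  hasDerivAt := ha
  isLittleO := by
    have hcubic : (fun s => NormedSpace.exp (a s) - (1 + a s + (1 / 2 : ℝ) • (a s * a s)))
        =o[𝓝 0] fun s => s ^ 2 :=
      ((isBigO_exp_sub_quadratic.comp_tendsto (ha0 ▸ ha.continuousAt.tendsto)).trans
        ((isBigO_id_of_hasDerivAt ha0 ha).norm_left.pow 3)).trans_isLittleO
        (isLittleO_pow_pow (𝕜 := ℝ) (by norm_num))
    have hsq := (isLittleO_mul_sub_sq_smul ha0 ha ha0 ha).const_smul_left (1 / 2 : ℝ)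
    refine (hcubic.add hsq).congr_left fun s => ?_
    simp only [Pi.smul_apply, smul_sub, smul_comm (s ^ 2) (1 / 2 : ℝ)]
    abel

/-- The second order term `½ ∑ₜ Zₜ² + ∑_{t < u} Zₜ Zᵤ` of the ordered product `∏ₜ exp (s Zₜ)`. -/
def quadraticTerm {R : Type*} [NonUnitalNonAssocSemiring R] [Module ℝ R] {r : ℕ}
    (Z : Fin r → R) : R :=
  ∑ t, (1 / 2 : ℝ) • (Z t * Z t) + ∑ t, ∑ u ∈ Finset.Ioi t, Z t * Z u

theorem quadraticTerm_succ {R : Type*} [NonUnitalNonAssocSemiring R] [Module ℝ R] {r : ℕ}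
    (Z : Fin (r + 1) → R) :
    quadraticTerm Z = (1 / 2 : ℝ) • (Z 0 * Z 0) + (quadraticTerm fun t : Fin r => Z t.succ)
      + Z 0 * ∑ t : Fin r, Z t.succ := by
  simp only [quadraticTerm, Fin.sum_univ_succ, Fin.sum_Ioi_zero, Fin.sum_Ioi_succ, Finset.mul_sum]
  abel

theorem HasSecondOrderExpansion.prod_exp {r : ℕ} {Y : Fin r → ℝ → 𝔸} {Z : Fin r → 𝔸}
    (hY0 : ∀ t, Y t 0 = 0) (hY : ∀ t, HasDerivAt (Y t) (Z t) 0) :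
    HasSecondOrderExpansion (fun s => (List.ofFn fun t => NormedSpace.exp (Y t s)).prod)
      (fun s => ∑ t, Y t s) (∑ t, Z t) (quadraticTerm Z) := by
  induction r with
  | zero => simpa [quadraticTerm] using HasSecondOrderExpansion.one
  | succ r ih =>
    simp only [List.ofFn_succ, List.prod_cons, Fin.sum_univ_succ, quadraticTerm_succ]
    exact (HasSecondOrderExpansion.exp (hY0 0) (hY 0)).mul
      (ih (fun t => hY0 t.succ) fun t => hY t.succ)

end SecondOrderExpansion

section CentralLimit

open Filter Asymptotics

theorem tendsto_inv_sqrt_natCast : Tendsto (fun n : ℕ => (Real.sqrt n)⁻¹) atTop (𝓝 0) :=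
  tendsto_inv_atTop_zero.comp (Real.tendsto_sqrt_atTop.comp tendsto_natCast_atTop_atTop)

theorem tendsto_pow_exp_of_isLittleO {u : ℝ → ℂ} {c : ℂ}
    (hu : (fun s => u s - (1 + s ^ 2 • c)) =o[𝓝 0] fun s => s ^ 2) :
    Tendsto (fun n : ℕ => u (Real.sqrt n)⁻¹ ^ n) atTop (𝓝 (Complex.exp c)) := by
  suffices hlim : Tendsto (fun n : ℕ => (n : ℂ) * (u (Real.sqrt n)⁻¹ - 1)) atTop (𝓝 c) by
    simpa only [add_sub_cancel] using Complex.tendsto_one_add_pow_exp_of_tendsto hlim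
  have hscaled := (hu.comp_tendsto tendsto_inv_sqrt_natCast).tendsto_inv_smul_nhds_zero.add_const c
  rw [zero_add] at hscaled
  refine hscaled.congr' ?_
  filter_upwards [eventually_ne_atTop 0] with n hn
  have hn' : (n : ℂ) ≠ 0 := Nat.cast_ne_zero.mpr hn
  simp only [Function.comp_apply, inv_pow, Real.sq_sqrt (Nat.cast_nonneg n), inv_inv,
    Complex.real_smul, Complex.ofReal_inv, Complex.ofReal_natCast]
  field_simp
  ring

theorem tendsto_map_prod_exp_pow {𝔸 : Type*} [NormedRing 𝔸] [NormedAlgebra ℝ 𝔸]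
    [CompleteSpace 𝔸] {φ : 𝔸 →L[ℝ] ℂ} (hφ : φ 1 = 1) {r : ℕ} {Y : Fin r → ℝ → 𝔸}
    {Z : Fin r → 𝔸} (hY0 : ∀ t, Y t 0 = 0) (hY : ∀ t, HasDerivAt (Y t) (Z t) 0)
    (hφY : ∀ t, (fun s => φ (Y t s)) =o[𝓝 0] fun s => s ^ 2) :
    Tendsto
      (fun n : ℕ => φ (List.ofFn fun t => NormedSpace.exp (Y t (Real.sqrt n)⁻¹)).prod ^ n)
      atTop (𝓝 (Complex.exp (φ (quadraticTerm Z)))) := by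
  have hfirst : (fun s => φ (∑ t, Y t s)) =o[𝓝 0] fun s => s ^ 2 := by
    simp only [map_sum]
    exact IsLittleO.fun_sum fun t _ => hφY t
  have hexpansion := (HasSecondOrderExpansion.prod_exp hY0 hY).apply_isLittleO φ hfirst
  rw [hφ] at hexpansion
  exact tendsto_pow_exp_of_isLittleO hexpansion

variable {d : ℕ}

theorem IsInfinitesimal.congr' {D : ℕ → Type*} [∀ n, Fintype (D n)] [∀ n, DecidableEq (D n)]
    {X : ∀ n, Fin d → Matrix (D n) (D n) ℂ} {ρ R S : ∀ n, Matrix (D n) (D n) ℂ}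
    {J : Matrix (Fin d) (Fin d) ℂ} (hR : IsInfinitesimal X ρ J R)
    (hRS : ∀ᶠ n in atTop, R n = S n) : IsInfinitesimal X ρ J S := fun r ξ η =>
  (hR r ξ η).congr' (hRS.mono fun n hn => by rw [hn])

theorem IsInfinitesimal.convergesInLaw {D : ℕ → Type*} [∀ n, Fintype (D n)]
    [∀ n, DecidableEq (D n)] {X : ∀ n, Fin d → Matrix (D n) (D n) ℂ}
    {ρ R : ∀ n, Matrix (D n) (D n) ℂ} {J : Matrix (Fin d) (Fin d) ℂ}
    (hR : IsInfinitesimal X ρ J R) : ConvergesInLaw X ρ 0 J := fun r ξ => by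
  simpa only [Pi.zero_apply, zero_smul, add_zero] using hR r ξ 0

variable {D : Type*} [Fintype D]

theorem trace_mul_add_smul_mul_add_smul {ρ W : Matrix D D ℂ} (hρW : ρ * W = 0) (hWρ : W * ρ = 0)
    (X Y : Matrix D D ℂ) (a b : ℂ) :
    (ρ * ((X + a • W) * (Y + b • W))).trace = (ρ * X * Y).trace := by
  have hleft : ρ * (X + a • W) = ρ * X := by
    rw [mul_add, Matrix.mul_smul, hρW, smul_zero, add_zero]
  have hright : (ρ * X * W).trace = 0 := by
    rw [Matrix.trace_mul_comm, ← mul_assoc, hWρ, zero_mul, Matrix.trace_zero]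
  rw [← mul_assoc, hleft, mul_add, Matrix.mul_smul, Matrix.trace_add, Matrix.trace_smul, hright,
    smul_zero, add_zero]

theorem trace_mul_quadraticTerm (ρ : Matrix D D ℂ) {r : ℕ} (Z : Fin r → Matrix D D ℂ) :
    (ρ * quadraticTerm Z).trace = ∑ t, (1 / 2) * (ρ * (Z t * Z t)).trace
      + ∑ t, ∑ u ∈ Finset.Ioi t, (ρ * (Z t * Z u)).trace := by
  simp [quadraticTerm, mul_add, Matrix.mul_sum, Matrix.trace_sum]

theorem exp_trace_mul_quadraticTerm {ρ W : Matrix D D ℂ} (hρW : ρ * W = 0) (hWρ : W * ρ = 0)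
    (A : Fin d → Matrix D D ℂ) {r : ℕ} (ξ : Fin r → Fin d → ℂ) (η : Fin r → ℂ) :
    Complex.exp (ρ * quadraticTerm fun t => Complex.I • (∑ i, ξ t i • A i + η t • W)).trace
      = gaussianQuasiChar 0 (covMatrix ρ A) ξ := by
  have hpair (t u : Fin r) : (ρ * ((Complex.I • (∑ i, ξ t i • A i + η t • W))
      * (Complex.I • (∑ i, ξ u i • A i + η u • W)))).trace
      = -∑ i, ∑ j, ξ t i * ξ u j * covMatrix ρ A j i := by
    rw [smul_mul_smul_comm, Complex.I_mul_I, neg_one_smul, mul_neg, Matrix.trace_neg,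
      trace_mul_add_smul_mul_add_smul hρW hWρ, trace_mul_sum_mul_sum]
  simp only [trace_mul_quadraticTerm, hpair]
  simp [gaussianQuasiChar, sub_eq_add_neg]

open scoped Matrix.Norms.Frobenius

/-- The functional `M ↦ Tr ρ M`, the expectation in the state `ρ`. It is taken over `ℝ` because
it is applied to curves. -/
def expectation (ρ : Matrix D D ℂ) : Matrix D D ℂ →L[ℝ] ℂ :=
  LinearMap.toContinuousLinearMap (Matrix.traceLinearMap D ℝ ℂ ∘ₗ LinearMap.mulLeft ℝ ρ)

variable [DecidableEq D]

-- `ρ * W = 0` and `W * ρ = 0` keep the first-order part of `V` out of the limiting covariances.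
theorem isInfinitesimal_siteSum {ρ : Matrix D D ℂ} (hρ : ρ.trace = 1) {A : Fin d → Matrix D D ℂ}
    (hA : ∀ i, (ρ * A i).trace = 0) {V : ℝ → Matrix D D ℂ} {W : Matrix D D ℂ} (hV0 : V 0 = 0)
    (hV : HasDerivAt V W 0) (hρW : ρ * W = 0) (hWρ : W * ρ = 0)
    (hρV : (fun s => (ρ * V s).trace) =o[𝓝 0] fun s => s ^ 2) :
    IsInfinitesimal (D := fun n => Fin n → D) (fun n i => normalizedSum n (A i))
      (fun n => tensorPow n ρ) (covMatrix ρ A) fun n => siteSum n (V (Real.sqrt n)⁻¹) := by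
  intro r ξ η
  let Y (t : Fin r) (s : ℝ) : Matrix D D ℂ := Complex.I • (s • ∑ i, ξ t i • A i + η t • V s)
  have hY0 (t : Fin r) : Y t 0 = 0 := by simp [Y, hV0]
  have hY (t : Fin r) : HasDerivAt (Y t) (Complex.I • (∑ i, ξ t i • A i + η t • W)) 0 := by
    have hlin := (hasDerivAt_id (0 : ℝ)).smul_const (∑ i, ξ t i • A i)
    simp only [id_eq, one_smul] at hlin
    exact (hlin.add (hV.const_smul (η t))).const_smul Complex.I
  have hρY (t : Fin r) : (fun s => (ρ * Y t s).trace) =o[𝓝 0] fun s => s ^ 2 := by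
    refine (hρV.const_mul_left (Complex.I * η t)).congr_left fun s => ?_
    simp [Y, mul_add, Matrix.mul_sum, Matrix.trace_sum, hA, mul_assoc]
  have hsite (n : ℕ) (t : Fin r) :
      Complex.I • (∑ i, ξ t i • normalizedSum n (A i) + η t • siteSum n (V (Real.sqrt n)⁻¹))
        = siteSum n (Y t (Real.sqrt n)⁻¹) := by
    rw [sum_smul_normalizedSum, ← siteSum_smul, ← siteSum_add, ← siteSum_smul]
  rw [← exp_trace_mul_quadraticTerm hρW hWρ A ξ η]
  simp only [hsite, prod_exp_siteSum, ← tensorPow_mul, trace_tensorPow]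
  exact tendsto_map_prod_exp_pow (φ := expectation ρ)
    ((congrArg Matrix.trace (mul_one ρ)).trans hρ) hY0 hY hρY

end CentralLimit

section Score

open Filter Asymptotics

theorem hasDerivAt_comp_smul {E F : Type*} [NormedAddCommGroup E] [NormedSpace ℝ E]
    [NormedAddCommGroup F] [NormedSpace ℝ F] {f : E → F} (hf : DifferentiableAt ℝ f 0) (v : E) :
    HasDerivAt (fun s : ℝ => f (s • v)) (fderiv ℝ f 0 v) 0 := by
  simpa only [HasLineDerivAt, zero_add] using hf.hasFDerivAt.hasLineDerivAt v

theorem isLittleO_comp_smul {E F : Type*} [NormedAddCommGroup E] [NormedSpace ℝ E]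
    [NormedAddCommGroup F] {f : E → F} {k : ℕ} (hf : f =o[𝓝 0] fun v => ‖v‖ ^ k) (v : E) :
    (fun s : ℝ => f (s • v)) =o[𝓝 0] fun s => s ^ k := by
  have hline : Tendsto (fun s : ℝ => s • v) (𝓝 0) (𝓝 0) := by
    simpa only [zero_smul] using (show Continuous fun s : ℝ => s • v by fun_prop).tendsto 0
  refine (hf.comp_tendsto hline).trans_isBigO (IsBigO.of_bound (‖v‖ ^ k) (.of_forall fun s => ?_))
  simp [norm_smul, mul_pow, mul_comm]

theorem map_eq_sum_smul_single {ι F : Type*} [Fintype ι] [DecidableEq ι] [AddCommGroup F]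
    [Module ℝ F] (T : EuclideanSpace ℝ ι →ₗ[ℝ] F) (x : EuclideanSpace ℝ ι) :
    T x = ∑ i, x i • T (EuclideanSpace.single i 1) := by
  simpa using congrArg T ((EuclideanSpace.basisFun ι ℝ).sum_repr x).symm

theorem isSelfAdjoint_of_hasDerivAt {F : Type*} [NormedAddCommGroup F] [NormedSpace ℝ F]
    [StarAddMonoid F] [StarModule ℝ F] [ContinuousStar F] {f : ℝ → F} {f' : F} {s₀ : ℝ}
    (hf : HasDerivAt f f' s₀) (hself : ∀ᶠ s in 𝓝 s₀, IsSelfAdjoint (f s)) : IsSelfAdjoint f' :=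
  (hf.star.congr_of_eventuallyEq (hself.mono fun _ hs => hs.star_eq.symm)).unique hf

theorem eventually_add_smul_mem {E : Type*} [NormedAddCommGroup E] [NormedSpace ℝ E] {U : Set E}
    (hU : IsOpen U) {x : E} (hx : x ∈ U) (v : E) : ∀ᶠ s : ℝ in 𝓝 0, x + s • v ∈ U := by
  refine (show Continuous fun s : ℝ => x + s • v by fun_prop).continuousAt.eventually_mem
    (hU.mem_nhds ?_)
  simpa only [zero_smul, add_zero] using hx

section NormedAlgebra

variable {𝔸 E : Type*} [NormedRing 𝔸] [NormedAlgebra ℝ 𝔸] [CompleteSpace 𝔸]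
  [NormedAddCommGroup E] [NormedSpace ℝ E] {φ : 𝔸 →L[ℝ] E} {ℓ : ℝ → 𝔸} {B : 𝔸}

theorem apply_add_isLittleO_of_exp (hℓ0 : ℓ 0 = 0) (hℓ : HasDerivAt ℓ B 0)
    (hexp : (fun s => φ (NormedSpace.exp (ℓ s)) - φ 1) =o[𝓝 0] fun s => s ^ 2) :
    (fun s => φ (ℓ s) + s ^ 2 • φ ((1 / 2 : ℝ) • (B * B))) =o[𝓝 0] fun s => s ^ 2 := by
  have hremainder :=
    (φ.isBigO_comp _ _).trans_isLittleO (HasSecondOrderExpansion.exp hℓ0 hℓ).isLittleO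
  refine (hexp.sub hremainder).congr_left fun s => ?_
  simp only [map_sub, map_add, map_smul]
  abel

end NormedAlgebra

open scoped Matrix.Norms.Frobenius

variable {D : Type*} [Fintype D]

theorem frobenius_norm_sq_eq_re_trace (B : Matrix D D ℂ) : ‖B‖ ^ 2 = (Bᴴ * B).trace.re := by
  have hentry (z : ℂ) : (star z * z).re = ‖z‖ ^ 2 := by
    rw [← Complex.normSq_eq_norm_sq, Complex.star_def, ← Complex.normSq_eq_conj_mul_self,
      Complex.ofReal_re]
  rw [Matrix.frobenius_norm_def, ← Real.sqrt_eq_rpow, Real.sq_sqrt (by positivity),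
    Finset.sum_comm]
  simp only [Real.rpow_ofNat, Matrix.trace, Matrix.diag_apply, Matrix.mul_apply,
    Matrix.conjTranspose_apply, Complex.re_sum, hentry]

open scoped MatrixOrder in
theorem frobenius_norm_le_re_trace {M : Matrix D D ℂ} (hM : M.PosSemidef) :
    ‖M‖ ≤ M.trace.re := by
  classical
  obtain ⟨B, rfl⟩ := CStarAlgebra.nonneg_iff_eq_star_mul_self.mp hM.nonneg
  rw [Matrix.star_eq_conjTranspose, ← frobenius_norm_sq_eq_re_trace, sq]
  simpa only [Matrix.frobenius_norm_conjTranspose] using Matrix.frobenius_norm_mul Bᴴ B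

variable {d : ℕ} {θ₀ : Param d} {ρ : Param d → Matrix D D ℂ} {i : Fin d}

theorem IsSLD.deriv_coordCurve {A : Matrix D D ℂ} (hA : IsSLD ρ θ₀ i A) :
    deriv (coordCurve ρ θ₀ i) 0 = (1 / 2 : ℂ) • (ρ θ₀ * A + A * ρ θ₀) :=
  hA.2.deriv

theorem IsSLD.mul_sub_eq_zero (hρ : (ρ θ₀).PosSemidef) {A B : Matrix D D ℂ}
    (hA : IsSLD ρ θ₀ i A) (hB : IsSLD ρ θ₀ i B) : ρ θ₀ * (A - B) = 0 := by
  have hAB := smul_right_injective (Matrix D D ℂ) (one_div_ne_zero (two_ne_zero' ℂ))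
    (hA.2.unique hB.2)
  rw [← mul_add_mul_eq_zero_iff hρ (hA.1.sub hB.1), mul_sub, sub_mul, sub_add_sub_comm,
    sub_eq_zero]
  exact hAB

theorem IsSLD.trace_mul_eq_zero {Θ : Set (Param d)} (hΘ : IsOpen Θ) (hθ₀ : θ₀ ∈ Θ)
    (hρ : ∀ θ ∈ Θ, (ρ θ).trace = 1) {A : Matrix D D ℂ} (hA : IsSLD ρ θ₀ i A) :
    (ρ θ₀ * A).trace = 0 := by
  have htrace : HasDerivAt (fun s => (coordCurve ρ θ₀ i s).trace)
      ((1 / 2 : ℂ) • (ρ θ₀ * A + A * ρ θ₀)).trace 0 :=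
    (Matrix.traceLinearMap D ℝ ℂ).toContinuousLinearMap.hasFDerivAt.comp_hasDerivAt 0 hA.2
  have hconst : (fun s => (coordCurve ρ θ₀ i s).trace) =ᶠ[𝓝 0] fun _ => 1 :=
    (eventually_add_smul_mem hΘ hθ₀ _).mono fun _ hs => hρ _ hs
  have hzero := htrace.unique ((hasDerivAt_const 0 1).congr_of_eventuallyEq hconst)
  rw [Matrix.trace_smul, Matrix.trace_add, Matrix.trace_mul_comm A, smul_eq_mul] at hzero
  linear_combination hzero

variable [DecidableEq D]

theorem IsLogLikelihoodRatio.norm_sub_conj_le {σ ρ M : Matrix D D ℂ}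
    (hM : IsLogLikelihoodRatio σ ρ M) :
    ‖σ - NormedSpace.exp ((1 / 2 : ℂ) • M) * ρ * NormedSpace.exp ((1 / 2 : ℂ) • M)‖
      ≤ ‖(ρ * NormedSpace.exp M).trace - σ.trace‖ := by
  obtain ⟨-, _, σs, hdecomp, rfl⟩ := hM
  have hmass : (ρ * NormedSpace.exp M).trace - σ.trace = -σs.trace := by
    rw [hdecomp.eq_add, Matrix.trace_add, Matrix.trace_mul_cycle, exp_half_mul_exp_half,
      Matrix.trace_mul_comm, sub_add_cancel_left]
  rw [hmass, norm_neg, hdecomp.eq_add, add_sub_cancel_left]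
  exact (frobenius_norm_le_re_trace hdecomp.posSemidef_sing).trans (Complex.re_le_norm _)

-- The hypothesis on the traces says that `σ s` has singular part `o(s)` relative to `ρ`.
theorem hasDerivAt_of_isLogLikelihoodRatio {σ ℓ : ℝ → Matrix D D ℂ} {ρ B : Matrix D D ℂ}
    (hℓ0 : ℓ 0 = 0) (hℓ : HasDerivAt ℓ B 0)
    (hσ : ∀ᶠ s in 𝓝 0, IsLogLikelihoodRatio (σ s) ρ (ℓ s))
    (htrace : (fun s => (ρ * NormedSpace.exp (ℓ s)).trace - (σ s).trace) =o[𝓝 0] fun s => s) :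
    HasDerivAt σ ((1 / 2 : ℂ) • (ρ * B + B * ρ)) 0 := by
  let conj (s : ℝ) : Matrix D D ℂ :=
    NormedSpace.exp ((1 / 2 : ℂ) • ℓ s) * ρ * NormedSpace.exp ((1 / 2 : ℂ) • ℓ s)
  have hsing : (fun s => σ s - conj s) =o[𝓝 0] fun s => s :=
    (IsBigO.of_norm_eventuallyLE (hσ.mono fun _ hs => hs.norm_sub_conj_le)).trans_isLittleO
      htrace.norm_left
  have hhalf : HasDerivAt (fun s => NormedSpace.exp ((1 / 2 : ℂ) • ℓ s)) ((1 / 2 : ℂ) • B) 0 :=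
    (HasSecondOrderExpansion.exp (by simp [hℓ0]) (hℓ.const_smul (1 / 2 : ℂ))).hasDerivAt_apply
  have hdconj := (hhalf.mul_const ρ).mul hhalf
  refine (((hasDerivAt_zero_of_isLittleO hsing).add hdconj).congr_deriv ?_).congr_of_eventuallyEq
    (.of_forall fun s => ?_)
  · simp [hℓ0, add_comm]
  · simp [conj]

theorem isSLD_fderiv {Θ : Set (Param d)} {L : Param d → Matrix D D ℂ} (hΘ : IsOpen Θ)
    (hθ₀ : θ₀ ∈ Θ) (hρ : ∀ θ ∈ Θ, IsDensity (ρ θ))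
    (hL : ∀ h, θ₀ + h ∈ Θ → IsLogLikelihoodRatio (ρ (θ₀ + h)) (ρ θ₀) (L h)) (hL0 : L 0 = 0)
    (hdiff : DifferentiableAt ℝ L 0)
    (htrace : (fun h => (ρ θ₀ * NormedSpace.exp (L h)).trace - 1) =o[𝓝 0] fun h => ‖h‖ ^ 2)
    (i : Fin d) : IsSLD ρ θ₀ i (fderiv ℝ L 0 (EuclideanSpace.single i (1 : ℝ))) := by
  let e : Param d := EuclideanSpace.single i 1
  have hmem : ∀ᶠ s : ℝ in 𝓝 0, θ₀ + s • e ∈ Θ := eventually_add_smul_mem hΘ hθ₀ e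
  have hcurve : ∀ᶠ s : ℝ in 𝓝 0,
      IsLogLikelihoodRatio (coordCurve ρ θ₀ i s) (ρ θ₀) (L (s • e)) :=
    hmem.mono fun s hs => hL (s • e) hs
  have hLe : HasDerivAt (fun s : ℝ => L (s • e)) (fderiv ℝ L 0 e) 0 := hasDerivAt_comp_smul hdiff e
  have hdefect : (fun s : ℝ => (ρ θ₀ * NormedSpace.exp (L (s • e))).trace
      - (coordCurve ρ θ₀ i s).trace) =o[𝓝 0] fun s => s := by
    refine ((isLittleO_comp_smul htrace e).trans (isLittleO_pow_id one_lt_two)).congr' ?_ .rfl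
    exact hmem.mono fun s hs => congrArg _ (hρ _ hs).2.symm
  exact ⟨isSelfAdjoint_of_hasDerivAt hLe (hcurve.mono fun _ hs => hs.1),
    hasDerivAt_of_isLogLikelihoodRatio (by rw [zero_smul, hL0]) hLe hcurve hdefect⟩

end Score

section Expansion

open Filter Asymptotics
open scoped Matrix.Norms.Frobenius

variable {d : ℕ} {D : Type*}

theorem siteSum_inv_sqrt_sq_smul_one [DecidableEq D] {n : ℕ} (hn : n ≠ 0) (a : ℂ) :
    siteSum n (((Real.sqrt n)⁻¹ ^ 2) • a • (1 : Matrix D D ℂ)) = a • 1 := by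
  have hn' : (n : ℂ) ≠ 0 := Nat.cast_ne_zero.mpr hn
  rw [← Complex.coe_smul, siteSum_smul, siteSum_smul, siteSum_one, inv_pow,
    Real.sq_sqrt (Nat.cast_nonneg n), Complex.ofReal_inv, Complex.ofReal_natCast,
    smul_comm a, inv_smul_smul₀ hn']

variable [Fintype D]

theorem trace_mul_mul_self_eq_sum_covMatrix {ρ B : Matrix D D ℂ} {A : Fin d → Matrix D D ℂ}
    {x : Fin d → ℂ} (hρB : ρ * (B - ∑ i, x i • A i) = 0) (hBρ : (B - ∑ i, x i • A i) * ρ = 0) :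
    (ρ * (B * B)).trace = ∑ i, ∑ j, covMatrix ρ A i j * x i * x j := by
  have hBB := trace_mul_add_smul_mul_add_smul hρB hBρ (∑ i, x i • A i) (∑ i, x i • A i) 1 1
  rw [one_smul, add_sub_cancel, trace_mul_sum_mul_sum, Finset.sum_comm] at hBB
  rw [hBB]
  exact Finset.sum_congr rfl fun i _ => Finset.sum_congr rfl fun j _ => by ring

variable [DecidableEq D]

theorem isInfinitesimal_siteSum_sub {ρ : Matrix D D ℂ} (hρ : ρ.trace = 1)
    {A : Fin d → Matrix D D ℂ} (hA : ∀ i, (ρ * A i).trace = 0) {x : Fin d → ℂ}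
    {ℓ : ℝ → Matrix D D ℂ} {B : Matrix D D ℂ} (hℓ0 : ℓ 0 = 0) (hℓ : HasDerivAt ℓ B 0)
    (hexp : (fun s => (ρ * NormedSpace.exp (ℓ s)).trace - 1) =o[𝓝 0] fun s => s ^ 2)
    (hρB : ρ * (B - ∑ i, x i • A i) = 0) (hBρ : (B - ∑ i, x i • A i) * ρ = 0) :
    IsInfinitesimal (D := fun n => Fin n → D) (fun n i => normalizedSum n (A i))
      (fun n => tensorPow n ρ) (covMatrix ρ A) fun n =>
        siteSum n (ℓ (Real.sqrt n)⁻¹) - ((∑ i, x i • normalizedSum n (A i))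
          - ((1 / 2 : ℂ) * ∑ i, ∑ j, covMatrix ρ A i j * x i * x j) • 1) := by
  rw [← trace_mul_mul_self_eq_sum_covMatrix hρB hBρ]
  set X := ∑ i, x i • A i with hX
  set a : ℂ := 1 / 2 * (ρ * (B * B)).trace with ha
  let V (s : ℝ) : Matrix D D ℂ := ℓ s - s • X + s ^ 2 • a • 1
  have hV0 : V 0 = 0 := by simp [V, hℓ0]
  have hV : HasDerivAt V (B - X) 0 := by
    have hlin := (hasDerivAt_id (0 : ℝ)).smul_const X
    have hquad := (hasDerivAt_pow 2 (0 : ℝ)).smul_const (a • (1 : Matrix D D ℂ))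
    exact ((hℓ.sub hlin).add hquad).congr_deriv (by simp)
  have hρX : (ρ * X).trace = 0 := by simp [hX, Matrix.mul_sum, Matrix.trace_sum, hA]
  have hρV : (fun s => (ρ * V s).trace) =o[𝓝 0] fun s => s ^ 2 := by
    rw [← hρ, ← congrArg Matrix.trace (mul_one ρ)] at hexp
    refine (apply_add_isLittleO_of_exp (φ := expectation ρ) hℓ0 hℓ hexp).congr_left fun s => ?_
    change (ρ * ℓ s).trace + s ^ 2 • (ρ * ((1 / 2 : ℝ) • (B * B))).trace = _
    simp [V, mul_add, mul_sub, hρX, hρ, ha]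
  refine (isInfinitesimal_siteSum hρ hA hV0 hV hρB hBρ hρV).congr' ?_
  filter_upwards [eventually_ne_atTop 0] with n hn
  rw [sum_smul_normalizedSum, siteSum_add, siteSum_sub, siteSum_inv_sqrt_sq_smul_one hn, ← sub_add]

end Expansion

section LocalAsymptoticNormality

open scoped Matrix.Norms.Frobenius

variable {d : ℕ} {D : Type*} [Fintype D] {θ₀ : Param d} {ρ L : Param d → Matrix D D ℂ}
  {A : Fin d → Matrix D D ℂ}

theorem mul_fderiv_sub_sum_eq_zero (hρ : (ρ θ₀).PosSemidef)
    (hSLD : ∀ i, IsSLD ρ θ₀ i (fderiv ℝ L 0 (EuclideanSpace.single i 1)))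
    (hA : ∀ i, IsSLD ρ θ₀ i (A i)) (h : Param d) :
    ρ θ₀ * (fderiv ℝ L 0 h - ∑ i, (h i : ℂ) • A i) = 0 ∧
      (fderiv ℝ L 0 h - ∑ i, (h i : ℂ) • A i) * ρ θ₀ = 0 := by
  have hsum : fderiv ℝ L 0 h - ∑ i, (h i : ℂ) • A i
      = ∑ i, (h i : ℂ) • (fderiv ℝ L 0 (EuclideanSpace.single i 1) - A i) := by
    simp only [smul_sub, Finset.sum_sub_distrib, Complex.coe_smul]
    exact congrArg (· - _) (map_eq_sum_smul_single (fderiv ℝ L 0).toLinearMap h)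
  have hleft : ρ θ₀ * (fderiv ℝ L 0 h - ∑ i, (h i : ℂ) • A i) = 0 := by
    rw [hsum, Matrix.mul_sum]
    refine Finset.sum_eq_zero fun i _ => ?_
    rw [Matrix.mul_smul, (hSLD i).mul_sub_eq_zero hρ (hA i), smul_zero]
  have hherm : (fderiv ℝ L 0 h - ∑ i, (h i : ℂ) • A i).IsHermitian := by
    rw [hsum]
    exact isHermitian_sum_ofReal_smul (fun i => (hSLD i).1.sub (hA i).1) _
  exact ⟨hleft, (mul_eq_zero_comm_of_isHermitian hρ.isHermitian hherm).mp hleft⟩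

theorem hasQLANExpansion_tensorPow [DecidableEq D] {Θ : Set (Param d)} (hΘ : IsOpen Θ)
    (hθ₀ : θ₀ ∈ Θ) (hρ : ∀ θ ∈ Θ, IsDensity (ρ θ))
    (hL : ∀ h, θ₀ + h ∈ Θ → IsLogLikelihoodRatio (ρ (θ₀ + h)) (ρ θ₀) (L h)) (hL0 : L 0 = 0)
    (hdiff : DifferentiableAt ℝ L 0)
    (htrace : (fun h => (ρ θ₀ * NormedSpace.exp (L h)).trace - 1) =o[𝓝 0] fun h => ‖h‖ ^ 2)
    (hA : ∀ i, IsSLD ρ θ₀ i (A i)) :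
    HasQLANExpansion Θ θ₀ (fun n θ => tensorPow n (ρ θ)) (fun n i => normalizedSum n (A i))
      (covMatrix (ρ θ₀) A) fun n h => siteSum n (L ((Real.sqrt n)⁻¹ • h)) := by
  have hρ₀ := hρ θ₀ hθ₀
  have hexpansion (h : Param d) :=
    have hsupp := mul_fderiv_sub_sum_eq_zero hρ₀.1
      (isSLD_fderiv hΘ hθ₀ hρ hL hL0 hdiff htrace) hA h
    isInfinitesimal_siteSum_sub hρ₀.2
      (fun i => (hA i).trace_mul_eq_zero hΘ hθ₀ fun θ hθ => (hρ θ hθ).2)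
      (by rw [zero_smul, hL0]) (hasDerivAt_comp_smul hdiff h) (isLittleO_comp_smul htrace h)
      hsupp.1 hsupp.2
  exact
    { isOpen := hΘ
      mem := hθ₀
      density := fun n θ hθ => (hρ θ hθ).tensorPow
      absCont := fun n θ hθ => by
        have hratio := hL (θ - θ₀) (by rwa [add_sub_cancel])
        rw [add_sub_cancel] at hratio
        exact (hratio.siteSum hρ₀.1 n).absCont hρ₀.tensorPow.1
      observable := fun n i => isHermitian_normalizedSum (hA i).1
      posSemidef := posSemidef_covMatrix hρ₀.1 fun i => (hA i).1
      convergesInLaw := (hexpansion 0).convergesInLaw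
      logLikelihoodRatio := fun n h hh => (hL _ hh).siteSum hρ₀.1 n
      logLikelihoodRatio_zero := fun n => by
        rw [smul_zero, hL0, ← siteSumLinear_apply, map_zero]
      expansion := hexpansion }

end LocalAsymptoticNormality

end QLAN

end

theorem mainTheorem2 {d : ℕ} {D : Type*} [Fintype D] [DecidableEq D]
    (Θ : Set (QLAN.Param d)) (hΘ : IsOpen Θ) (θ₀ : QLAN.Param d) (hθ₀ : θ₀ ∈ Θ)
    (ρ : QLAN.Param d → Matrix D D ℂ) (hρ : ∀ θ ∈ Θ, QLAN.IsDensity (ρ θ))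
    (hac : ∀ θ ∈ Θ, QLAN.AbsCont (ρ θ₀) (ρ θ))
    -- `L h` is a version of the quantum log-likelihood ratio, normalized by `𝓛(ρ | ρ) = 0`
    (L : QLAN.Param d → Matrix D D ℂ)
    (hL : ∀ h, θ₀ + h ∈ Θ → QLAN.IsLogLikelihoodRatio (ρ (θ₀ + h)) (ρ θ₀) (L h))
    (hL0 : L 0 = 0)
    (hdiff : DifferentiableAt ℝ L 0)
    (htrace : (fun h => (ρ θ₀ * NormedSpace.exp (L h)).trace - 1)
      =o[𝓝 (0 : QLAN.Param d)] fun h => ‖h‖ ^ 2) :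
    -- the log-likelihood ratio of the tensor powers is the sum of the single-site ratios
    (∀ (n : ℕ), ∀ θ ∈ Θ, ∀ M : Matrix D D ℂ, QLAN.IsLogLikelihoodRatio (ρ θ) (ρ θ₀) M →
      QLAN.IsLogLikelihoodRatio (QLAN.tensorPow n (ρ θ)) (QLAN.tensorPow n (ρ θ₀))
        (QLAN.siteSum n M)) ∧
    -- the partial derivatives of `L` at `0` are versions of the SLDs
    (∀ i, QLAN.IsSLD ρ θ₀ i (fderiv ℝ L 0 (EuclideanSpace.single i (1 : ℝ)))) ∧
    -- for all versions `A i` of the SLDs the tensor powers are q-LAN (with `Re J > 0` exactly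
    -- where the partial derivatives of the model at `θ₀` are linearly independent)
    ∀ A : Fin d → Matrix D D ℂ, (∀ i, QLAN.IsSLD ρ θ₀ i (A i)) →
      QLAN.HasQLANExpansion Θ θ₀ (fun n θ => QLAN.tensorPow n (ρ θ))
        (fun n i => QLAN.normalizedSum n (A i)) (QLAN.covMatrix (ρ θ₀) A)
        (fun n h => QLAN.siteSum n (L ((Real.sqrt n)⁻¹ • h))) ∧
      (QLAN.IsQLAN Θ θ₀ (fun n θ => QLAN.tensorPow n (ρ θ))
        (fun n i => QLAN.normalizedSum n (A i)) (QLAN.covMatrix (ρ θ₀) A)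
        (fun n h => QLAN.siteSum n (L ((Real.sqrt n)⁻¹ • h))) ↔
        LinearIndependent ℝ fun i => deriv (QLAN.coordCurve ρ θ₀ i) 0) := by
  have hρ₀ := (hρ θ₀ hθ₀).1
  refine ⟨fun n _ _ _ hM => hM.siteSum hρ₀ n,
    QLAN.isSLD_fderiv hΘ hθ₀ hρ hL hL0 hdiff htrace, fun A hA => ?_⟩
  have hexpansion := QLAN.hasQLANExpansion_tensorPow hΘ hθ₀ hρ hL hL0 hdiff htrace hA
  have hposDef := QLAN.posDef_re_covMatrix_iff hρ₀ fun i => (hA i).1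
  simp only [← (hA _).deriv_coordCurve] at hposDef
  exact ⟨hexpansion, fun hqlan => hposDef.mp hqlan.posDef_re,
    fun hindep => { hexpansion with posDef_re := hposDef.mpr hindep }⟩
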